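/- Rings are associative with $1$ and modules are unital. Let $M$ be a nonzero right module over a ring $R$. Regard elements of $M^n$ as row vectors; an $n\times m$ matrix $A$ over $R$ induces the additive map $M^n\to M^m$, $x\mapsto xA$, and a column vector of height $n$ over $R$ likewise induces an additive map $M^n\to M$. Let $\mathcal P$ be the set of square matrices $A$ over $R$ such that, if $A$ is $n\times n$, the map $A:M^n\to M^n$ is not injective. Write $A\oplus B=\begin{pmatrix}A&0\\0&B\end{pmatrix}$. If square matrices $A,B$ of the same size agree except in the $r$-th column (respectively row), their determinantal sum $A\nabla B$ with respect to that column (row) is the matrix agreeing with $A$ and $B$ elsewhere whose $r$-th column (row) is the sum of the $r$-th columns (rows) of $A$ and $B$. Consider the following conditions on a set $\mathcal P$ of square matrices over $R$: 1. $\mathcal P$ contains every non-full matrix, i.e. every $n\times n$ matrix ($n>0$) which is the product of an $n\times(n-1)$ and an $(n-1)\times n$ matrix over $R$; 2. if $A\in\mathcal P$ and $B$ is any square matrix over $R$, then $A\oplus B\in\mathcal P$; 3. if $A,B\in\mathcal P$ agree except in the $r$-th column, then their determinantal sum with respect to that column is in $\mathcal P$; 4. if $A,B\in\mathcal P$ agree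 except in the $r$-th row, then their determinantal sum with respect to that row is in $\mathcal P$; 5. if $A\oplus 1\in\mathcal P$, where $1$ is the $1\times1$ identity matrix, then $A\in\mathcal P$; 6. the $1\times 1$ matrix $1$ is not in $\mathcal P$; 7. if $A\oplus B\in\mathcal P$, then $A\in\mathcal P$ or $B\in\mathcal P$; 8. for each $n>0$, the set of $n\times n$ matrices in $\mathcal P$ is closed under left multiplication by the matrices $I_n\pm e_{ij}$ $(i\ne j)$. A set of square matrices satisfying 1–7 is called a prime matrix ideal of $R$. Then, for the set $\mathcal P$ of matrices acting non-injectively: (i) $\mathcal P$ satisfies 2, 5, 6, 7 and 8. (ii) $\mathcal P$ satisfies 1 if and only if (∗) for $n>0$, no $n\times(n-1)$ matrix over $R$ induces an injection $M^n\to M^{n-1}$. (iii) $\mathcal P$ satisfies 3 if the following condition holds: (∗∗) whenever $n>0$ and $K\subseteq M^n$ is the kernel of the action on $M^n$ of an $n\times(n-1)$ matrix over $R$, either (a) every map $M^n\to M$ which is induced by a column vector of height $n$ over $R$ and is nonzero on $K$ is one-to-one on $K$, or (b) no map $M^n\to M$ induced by a column vector of height $n$ over $R$ is one-to-one on $K$.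 Thus, if both (∗) and (∗∗) hold, then $\mathcal P$ is a prime matrix ideal of $R$. If, further, the right $R$-module $M$ is faithful, then $R$ is embeddable in a division ring. -/

import Mathlib

universe u v

namespace PrimeMatrixIdeal

/-- A set of square matrices over `R`, of all finite sizes: for each `n`, a set of `n × n`
matrices. -/
abbrev SquareMatrixSet (R : Type*) : Type _ :=
  ∀ n : ℕ, Set (Matrix (Fin n) (Fin n) R)

section Conditions

variable {R : Type*} [Ring R]

/-- The block-diagonal matrix `A ⊕ B` with diagonal blocks `A` and `B`. -/
def diagSum {m n : ℕ} (A : Matrix (Fin m) (Fin m) R) (B : Matrix (Fin n) (Fin n) R) :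
    Matrix (Fin (m + n)) (Fin (m + n)) R :=
  Matrix.reindex finSumFinEquiv finSumFinEquiv (Matrix.fromBlocks A 0 0 B)

/-- `A` and `B` agree except possibly in the `r`-th column. -/
def AgreeOffCol {n : ℕ} (r : Fin n) (A B : Matrix (Fin n) (Fin n) R) : Prop :=
  ∀ i j, j ≠ r → A i j = B i j

/-- `A` and `B` agree except possibly in the `r`-th row. -/
def AgreeOffRow {n : ℕ} (r : Fin n) (A B : Matrix (Fin n) (Fin n) R) : Prop :=
  ∀ i j, i ≠ r → A i j = B i j

/-- The determinantal sum of `A` and `B` with respect to the `r`-th column: the matrix `A` with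
its `r`-th column replaced by the sum of the `r`-th columns of `A` and `B`. It is used when
`AgreeOffCol r A B` holds. -/
def nablaCol {n : ℕ} (r : Fin n) (A B : Matrix (Fin n) (Fin n) R) :
    Matrix (Fin n) (Fin n) R :=
  A.updateCol r (fun i => A i r + B i r)

/-- The determinantal sum of `A` and `B` with respect to the `r`-th row: the matrix `A` with
its `r`-th row replaced by the sum of the `r`-th rows of `A` and `B`. It is used when
`AgreeOffRow r A B` holds. -/
def nablaRow {n : ℕ} (r : Fin n) (A B : Matrix (Fin n) (Fin n) R) :
    Matrix (Fin n) (Fin n) R :=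
  A.updateRow r (fun j => A r j + B r j)

/-- An `n × n` matrix (`n = k + 1 > 0`) is non-full if it is the product of an `n × (n - 1)`
matrix and an `(n - 1) × n` matrix. -/
def IsNonFull {k : ℕ} (A : Matrix (Fin (k + 1)) (Fin (k + 1)) R) : Prop :=
  ∃ (B : Matrix (Fin (k + 1)) (Fin k) R) (C : Matrix (Fin k) (Fin (k + 1)) R), A = B * C

/-- `P` contains every non-full matrix. -/
def ContainsNonFull (P : SquareMatrixSet R) : Prop :=
  ∀ (k : ℕ) (A : Matrix (Fin (k + 1)) (Fin (k + 1)) R), IsNonFull A → A ∈ P (k + 1)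

/-- If `A ∈ P` and `B` is any square matrix, then `A ⊕ B ∈ P`. -/
def ClosedDiagSum (P : SquareMatrixSet R) : Prop :=
  ∀ (m n : ℕ) (A : Matrix (Fin m) (Fin m) R) (B : Matrix (Fin n) (Fin n) R),
    A ∈ P m → diagSum A B ∈ P (m + n)

/-- `P` is closed under determinantal sums with respect to columns. -/
def ClosedNablaCol (P : SquareMatrixSet R) : Prop :=
  ∀ (n : ℕ) (r : Fin n) (A B : Matrix (Fin n) (Fin n) R),
    A ∈ P n → B ∈ P n → AgreeOffCol r A B → nablaCol r A B ∈ P n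

/-- `P` is closed under determinantal sums with respect to rows. -/
def ClosedNablaRow (P : SquareMatrixSet R) : Prop :=
  ∀ (n : ℕ) (r : Fin n) (A B : Matrix (Fin n) (Fin n) R),
    A ∈ P n → B ∈ P n → AgreeOffRow r A B → nablaRow r A B ∈ P n

/-- If `A ⊕ 1 ∈ P`, where `1` is the `1 × 1` identity matrix, then `A ∈ P`. -/
def CancelsOne (P : SquareMatrixSet R) : Prop :=
  ∀ (n : ℕ) (A : Matrix (Fin n) (Fin n) R),
    diagSum A (1 : Matrix (Fin 1) (Fin 1) R) ∈ P (n + 1) → A ∈ P n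

/-- The `1 × 1` identity matrix is not in `P`. -/
def OneNotMem (P : SquareMatrixSet R) : Prop :=
  (1 : Matrix (Fin 1) (Fin 1) R) ∉ P 1

/-- If `A ⊕ B ∈ P`, then `A ∈ P` or `B ∈ P`. -/
def PrimeCondition (P : SquareMatrixSet R) : Prop :=
  ∀ (m n : ℕ) (A : Matrix (Fin m) (Fin m) R) (B : Matrix (Fin n) (Fin n) R),
    diagSum A B ∈ P (m + n) → A ∈ P m ∨ B ∈ P n

/-- `P` is closed under left multiplication by the matrices `I ± e_{ij}` with `i ≠ j`. -/
def ClosedElementaryLeft (P : SquareMatrixSet R) : Prop :=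
  ∀ (n : ℕ) (i j : Fin n), i ≠ j → ∀ A : Matrix (Fin n) (Fin n) R, A ∈ P n →
    (1 + Matrix.single i j 1) * A ∈ P n ∧ (1 - Matrix.single i j 1) * A ∈ P n

/-- A matrix ideal in the sense of Cohn. -/
structure IsMatrixIdeal (P : SquareMatrixSet R) : Prop where
  containsNonFull : ContainsNonFull P
  closedDiagSum : ClosedDiagSum P
  closedNablaCol : ClosedNablaCol P
  closedNablaRow : ClosedNablaRow P
  cancelsOne : CancelsOne P

/-- A prime matrix ideal in the sense of Cohn. -/
structure IsPrimeMatrixIdeal (P : SquareMatrixSet R) : Prop extends IsMatrixIdeal P where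
  oneNotMem : OneNotMem P
  primeCondition : PrimeCondition P

end Conditions

section Action

/- A right `R`-module is a module over `Rᵐᵒᵖ`; the element usually written `x r` is
`MulOpposite.op r • x`. -/
variable {R : Type*} [Ring R] (M : Type*) [AddCommGroup M] [Module Rᵐᵒᵖ M]

/-- The map `M ^ n → M` induced by a column vector `c` of height `n`: it sends the row vector
`(x₁, …, xₙ)` to `x₁ c₁ + ⋯ + xₙ cₙ`. -/
def colAct {n : ℕ} (c : Fin n → R) : (Fin n → M) →+ M where
  toFun x := ∑ i, MulOpposite.op (c i) • x i
  map_zero' := by simp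
  map_add' x y := by simp [smul_add, Finset.sum_add_distrib]

/-- The map `M ^ n → M ^ m`, `x ↦ x A`, by which an `n × m` matrix `A` over `R` acts on row
vectors: the `j`-th entry of `x A` is the sum over `i` of `xᵢ Aᵢⱼ`. -/
def matAct {n m : ℕ} (A : Matrix (Fin n) (Fin m) R) : (Fin n → M) →+ (Fin m → M) where
  toFun x j := ∑ i, MulOpposite.op (A i j) • x i
  map_zero' := by ext j; simp
  map_add' x y := by ext j; simp [smul_add, Finset.sum_add_distrib]

/-- The set of square matrices `A` over `R`, say `n × n`, acting non-injectively on `M ^ n`. -/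
def nonInjective : SquareMatrixSet R :=
  fun n => {A : Matrix (Fin n) (Fin n) R | ¬ Function.Injective (matAct M A)}

variable (R)

/-- No `n × (n - 1)` matrix over `R` (`n = k + 1 > 0`) induces an injection
`M ^ n → M ^ (n - 1)`. -/
def NoInjectiveTall : Prop :=
  ∀ (k : ℕ) (C : Matrix (Fin (k + 1)) (Fin k) R), ¬ Function.Injective (matAct M C)

/-- If `K ⊆ M ^ n` (`n = k + 1 > 0`) is the kernel of the action of an `n × (n - 1)` matrix over
`R`, then either every map `M ^ n → M` which is induced by a column vector and is nonzero on `K`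
is one-to-one on `K`, or no map induced by a column vector is one-to-one on `K`. -/
def KernelDichotomy : Prop :=
  ∀ (k : ℕ) (C : Matrix (Fin (k + 1)) (Fin k) R) (K : AddSubgroup (Fin (k + 1) → M)),
    K = (matAct M C).ker →
    (∀ c : Fin (k + 1) → R, (∃ x ∈ K, colAct M c x ≠ 0) →
        Set.InjOn (colAct M c) (K : Set (Fin (k + 1) → M))) ∨
    (∀ c : Fin (k + 1) → R, ¬ Set.InjOn (colAct M c) (K : Set (Fin (k + 1) → M)))

end Action

end PrimeMatrixIdeal

/-! Conditions 2, 5, 6, 7 and 8 hold because the kernel of `A ⊕ B` is the product of the two kernels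
and because the matrices `I ± e_ij` are invertible. For 1, bordering an `n × (n - 1)` matrix by a
zero column makes it a non-full square matrix with the same kernel. For 3, apply (∗∗) to the kernel
`K` of the common part of `A` and `B`, the matrix without its `r`-th column.

Condition 4 and the embedding both come from a division ring `D` built out of `M`. Let `K` be the
kernel of an `n × (n - 1)` matrix, `v` a column injective on `K`, and `c` any column. Then `x v ↦ x
c` (`x ∈ K`) is a partial additive map on `M`. By (∗) its domain is nonzero; by (∗∗) it is zero or
injective. Pullbacks of two such kernels again have one more row than columns, so these maps are
closed under sums and composites, and exchanging `v` and `c` gives inverses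
(`isGermSystem_kerGraphs`). Two of them that agree at one nonzero point agree wherever both are
defined, so their germs form a division ring `D`, to which `R` maps by its action on `M`. This map
is injective if `M` is faithful.

The key is that a square matrix acts non-injectively on `M ^ n` exactly if its image over `D` is
singular (`mem_nonInjective_iff_singular`). An injective matrix gets a left inverse over `D`, row by
row, from the kernels left by deleting one column (`exists_germ_leftInverse`). Conversely, if the
columns are independent over `D`, they can be exchanged one at a time for columns of the identity
without losing injectivity (`exists_exchange`). Condition 4 then becomes linear algebra over `D`. -/

namespace PrimeMatrixIdeal

/-! ### Partial additive maps, handled through their graphs. -/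

section Graphs

variable {M : Type*} [AddCommGroup M]

/-- The graph of the sum of two partial maps, defined on the intersection of their domains. -/
def graphAdd (Γ Δ : AddSubgroup (M × M)) : AddSubgroup (M × M) where
  carrier := {p | ∃ y z, (p.1, y) ∈ Γ ∧ (p.1, z) ∈ Δ ∧ y + z = p.2}
  zero_mem' := ⟨0, 0, Γ.zero_mem, Δ.zero_mem, by simp⟩
  add_mem' := by
    rintro p q ⟨y, z, hy, hz, h⟩ ⟨y', z', hy', hz', h'⟩
    exact ⟨y + y', z + z', Γ.add_mem hy hy', Δ.add_mem hz hz', by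
      rw [Prod.snd_add, ← h, ← h']; abel⟩
  neg_mem' := by
    rintro p ⟨y, z, hy, hz, h⟩
    exact ⟨-y, -z, Γ.neg_mem hy, Δ.neg_mem hz, by rw [Prod.snd_neg, ← h]; abel⟩

/-- The graph of the composite of two partial maps, the left one being applied first. -/
def graphMul (Γ Δ : AddSubgroup (M × M)) : AddSubgroup (M × M) where
  carrier := {p | ∃ y, (p.1, y) ∈ Γ ∧ (y, p.2) ∈ Δ}
  zero_mem' := ⟨0, Γ.zero_mem, Δ.zero_mem⟩
  add_mem' := by
    rintro p q ⟨y, hy, hz⟩ ⟨y', hy', hz'⟩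
    exact ⟨y + y', Γ.add_mem hy hy', Δ.add_mem hz hz'⟩
  neg_mem' := by
    rintro p ⟨y, hy, hz⟩
    exact ⟨-y, Γ.neg_mem hy, Δ.neg_mem hz⟩

/-- The graph of the negative of a partial map. -/
def graphNeg (Γ : AddSubgroup (M × M)) : AddSubgroup (M × M) where
  carrier := {p | (p.1, -p.2) ∈ Γ}
  zero_mem' := by
    change ((0 : M), -(0 : M)) ∈ Γ
    rw [neg_zero]
    exact Γ.zero_mem
  add_mem' := by
    rintro p q hp hq
    have := Γ.add_mem hp hq
    simpa [add_comm] using this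
  neg_mem' := by
    rintro p hp
    simpa using Γ.neg_mem hp

/-- The converse of a graph. -/
def graphInv (Γ : AddSubgroup (M × M)) : AddSubgroup (M × M) where
  carrier := {p | (p.2, p.1) ∈ Γ}
  zero_mem' := Γ.zero_mem
  add_mem' hp hq := Γ.add_mem hp hq
  neg_mem' hp := Γ.neg_mem hp

/-- The graph of an everywhere defined additive map. -/
def graphHom (f : M →+ M) : AddSubgroup (M × M) where
  carrier := {p | p.2 = f p.1}
  zero_mem' := by simp
  add_mem' := by
    rintro p q (hp : _ = _) (hq : _ = _)
    simp [hp, hq]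
  neg_mem' := by
    rintro p (hp : _ = _)
    simp [hp]

/-- A family of graphs of partial additive maps with nonzero domains, each zero or injective,
that is stable under the formation of sums, negatives, composites and inverses. -/
structure IsGermSystem (G : Set (AddSubgroup (M × M))) : Prop where
  exists_ne : ∀ Γ ∈ G, ∃ x y, (x, y) ∈ Γ ∧ x ≠ 0
  functional : ∀ Γ ∈ G, ∀ y, (0, y) ∈ Γ → y = 0
  zero_or_injective : ∀ Γ ∈ G,
    (∀ x y, (x, y) ∈ Γ → y = 0) ∨ (∀ x, (x, 0) ∈ Γ → x = 0)
  add_mem : ∀ Γ ∈ G, ∀ Δ ∈ G, graphAdd Γ Δ ∈ G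
  mul_mem : ∀ Γ ∈ G, ∀ Δ ∈ G, graphMul Γ Δ ∈ G
  neg_mem : ∀ Γ ∈ G, graphNeg Γ ∈ G
  inv_mem : ∀ Γ ∈ G, (∀ x, (x, 0) ∈ Γ → x = 0) → graphInv Γ ∈ G
  zero_mem : graphHom 0 ∈ G
  one_mem : graphHom (AddMonoidHom.id M) ∈ G

namespace IsGermSystem

variable {G : Set (AddSubgroup (M × M))}

theorem unique (hG : IsGermSystem G) {Γ : AddSubgroup (M × M)} (hΓ : Γ ∈ G) {x y z : M} (hy : (x, y) ∈ Γ)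
    (hz : (x, z) ∈ Γ) : y = z :=
  sub_eq_zero.1 (hG.functional Γ hΓ _ (by simpa using Γ.sub_mem hy hz))

/-- The difference of the two maps lies in the system and vanishes at the nonzero point `x`. Hence
it is not injective, so it is zero on the common domain. -/
theorem agree (hG : IsGermSystem G) {Γ Δ : AddSubgroup (M × M)} (hΓ : Γ ∈ G) (hΔ : Δ ∈ G) {x y : M} (hx : x ≠ 0)
    (h₁ : (x, y) ∈ Γ) (h₂ : (x, y) ∈ Δ) {a b c : M} (hb : (a, b) ∈ Γ) (hc : (a, c) ∈ Δ) :
    b = c := by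
  have key : graphAdd Γ (graphNeg Δ) ∈ G := hG.add_mem _ hΓ _ (hG.neg_mem _ hΔ)
  rcases hG.zero_or_injective _ key with h | h
  · have := h a (b + -c) ⟨b, -c, hb, by simpa [graphNeg] using hc, rfl⟩
    exact add_neg_eq_zero.1 this
  · exact absurd (h x ⟨y, -y, h₁, by simpa [graphNeg] using h₂, by simp⟩) hx

variable (hG : IsGermSystem G)

/-- Two partial maps have the same germ if they agree wherever both are defined. -/
def setoid : Setoid G where
  r Γ Δ := ∀ x y z, (x, y) ∈ Γ.1 → (x, z) ∈ Δ.1 → y = z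
  iseqv :=
    { refl := fun Γ _ _ _ hy hz => hG.unique Γ.2 hy hz
      symm := fun h x y z hy hz => (h x z y hz hy).symm
      trans := by
        rintro Γ Δ Λ h h' a b c hb hc
        -- A sum is defined on the intersection of the domains, so adding all three maps yields a
        -- nonzero point common to them; `agree` carries the equality from there to the given point.
        obtain ⟨x, _, ⟨s, t, ⟨y, z, hy, hz, -⟩, ht, -⟩, hx⟩ := hG.exists_ne _
          (hG.add_mem _ (hG.add_mem _ Γ.2 _ Δ.2) _ Λ.2)
        obtain rfl := h x y z hy hz
        obtain rfl := h' x y t hz ht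
        exact hG.agree Γ.2 Λ.2 hx hy ht hb hc }

/-- The germs of a germ system. -/
def Germ : Type _ := Quotient hG.setoid

/-! ### The division ring of germs. -/

namespace Germ

instance : Zero hG.Germ := ⟨Quotient.mk hG.setoid ⟨_, hG.zero_mem⟩⟩
instance : One hG.Germ := ⟨Quotient.mk hG.setoid ⟨_, hG.one_mem⟩⟩

instance : Add hG.Germ :=
  ⟨Quotient.map₂ (sa := hG.setoid) (sb := hG.setoid) (sc := hG.setoid)
    (fun Γ Δ => ⟨_, hG.add_mem _ Γ.2 _ Δ.2⟩) (by
      rintro Γ Γ' h Δ Δ' h' x y z ⟨a, b, ha, hb, rfl⟩ ⟨a', b', ha', hb', rfl⟩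
      exact congrArg₂ _ (h _ _ _ ha ha') (h' _ _ _ hb hb'))⟩

instance : Mul hG.Germ :=
  ⟨Quotient.map₂ (sa := hG.setoid) (sb := hG.setoid) (sc := hG.setoid)
    (fun Γ Δ => ⟨_, hG.mul_mem _ Γ.2 _ Δ.2⟩) (by
      rintro Γ Γ' h Δ Δ' h' x y z ⟨a, ha, hb⟩ ⟨a', ha', hb'⟩
      obtain rfl := h _ _ _ ha ha'
      exact h' _ _ _ hb hb')⟩

instance : Neg hG.Germ :=
  ⟨Quotient.map (sa := hG.setoid) (sb := hG.setoid) (fun Γ => ⟨_, hG.neg_mem _ Γ.2⟩) (by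
      rintro Γ Γ' h x y z hy hz
      exact neg_injective (h _ _ _ hy hz))⟩

/-- `Rep d x y`: the germ `d` has a representative that is defined at `x` with value `y`. -/
def Rep (d : hG.Germ) (x y : M) : Prop :=
  ∃ Γ : G, Quotient.mk hG.setoid Γ = d ∧ (x, y) ∈ Γ.1

variable {hG}

theorem Rep.unique {d : hG.Germ} {x y z : M} (hy : Rep hG d x y) (hz : Rep hG d x z) :
    y = z := by
  obtain ⟨Γ, rfl, hy⟩ := hy
  obtain ⟨Δ, h, hz⟩ := hz
  exact Quotient.exact (s := hG.setoid) h.symm _ _ _ hy hz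

/-- This reduces an identity between germs to one evaluation at a nonzero point; each ring axiom
below is checked in this way. -/
theorem Rep.eq {d e : hG.Germ} {x y : M} (hd : Rep hG d x y) (he : Rep hG e x y)
    (hx : x ≠ 0) : d = e := by
  obtain ⟨Γ, rfl, hy⟩ := hd
  obtain ⟨Δ, rfl, hz⟩ := he
  exact Quotient.sound (s := hG.setoid)
    fun _ _ _ hb hc => hG.agree Γ.2 Δ.2 hx hy hz hb hc

theorem Rep.add {d e : hG.Germ} {x y z : M} (hd : Rep hG d x y) (he : Rep hG e x z) :
    Rep hG (d + e) x (y + z) := by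
  obtain ⟨Γ, rfl, hy⟩ := hd
  obtain ⟨Δ, rfl, hz⟩ := he
  exact ⟨⟨_, hG.add_mem _ Γ.2 _ Δ.2⟩, rfl, y, z, hy, hz, rfl⟩

theorem Rep.mul {d e : hG.Germ} {x y z : M} (hd : Rep hG d x y) (he : Rep hG e y z) :
    Rep hG (d * e) x z := by
  obtain ⟨Γ, rfl, hy⟩ := hd
  obtain ⟨Δ, rfl, hz⟩ := he
  exact ⟨⟨_, hG.mul_mem _ Γ.2 _ Δ.2⟩, rfl, y, hy, hz⟩

theorem Rep.neg {d : hG.Germ} {x y : M} (hd : Rep hG d x y) : Rep hG (-d) x (-y) := by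
  obtain ⟨Γ, rfl, hy⟩ := hd
  exact ⟨⟨_, hG.neg_mem _ Γ.2⟩, rfl, by simpa [graphNeg] using hy⟩

variable (hG)

theorem rep_zero (x : M) : Rep hG 0 x 0 := ⟨⟨_, hG.zero_mem⟩, rfl, by simp [graphHom]⟩

theorem rep_one (x : M) : Rep hG 1 x x := ⟨⟨_, hG.one_mem⟩, rfl, by simp [graphHom]⟩

variable {hG}

theorem exists_rep (d : hG.Germ) : ∃ x y, Rep hG d x y ∧ x ≠ 0 := by
  obtain ⟨Γ, rfl⟩ := Quotient.exists_rep d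
  obtain ⟨x, y, h, hx⟩ := hG.exists_ne _ Γ.2
  exact ⟨x, y, ⟨Γ, rfl, h⟩, hx⟩

/-- Membership of the sum in the system is used only for the nonzero point it supplies, at which
both maps are defined. The variants below use the sum or composite that occurs in the corresponding
ring axiom. -/
theorem exists_rep_add (d e : hG.Germ) :
    ∃ x y z, Rep hG d x y ∧ Rep hG e x z ∧ x ≠ 0 := by
  obtain ⟨Γ, rfl⟩ := Quotient.exists_rep d
  obtain ⟨Δ, rfl⟩ := Quotient.exists_rep e
  obtain ⟨x, _, ⟨y, z, hy, hz, -⟩, hx⟩ := hG.exists_ne _ (hG.add_mem _ Γ.2 _ Δ.2)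
  exact ⟨x, y, z, ⟨Γ, rfl, hy⟩, ⟨Δ, rfl, hz⟩, hx⟩

theorem exists_rep_add₃ (d e f : hG.Germ) :
    ∃ x a b c, Rep hG d x a ∧ Rep hG e x b ∧ Rep hG f x c ∧ x ≠ 0 := by
  obtain ⟨Γ, rfl⟩ := Quotient.exists_rep d
  obtain ⟨Δ, rfl⟩ := Quotient.exists_rep e
  obtain ⟨Λ, rfl⟩ := Quotient.exists_rep f
  obtain ⟨x, _, ⟨_, c, ⟨a, b, ha, hb, -⟩, hc, -⟩, hx⟩ :=
    hG.exists_ne _ (hG.add_mem _ (hG.add_mem _ Γ.2 _ Δ.2) _ Λ.2)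
  exact ⟨x, a, b, c, ⟨Γ, rfl, ha⟩, ⟨Δ, rfl, hb⟩, ⟨Λ, rfl, hc⟩, hx⟩

theorem exists_rep_mul₃ (d e f : hG.Germ) :
    ∃ x a b c, Rep hG d x a ∧ Rep hG e a b ∧ Rep hG f b c ∧ x ≠ 0 := by
  obtain ⟨Γ, rfl⟩ := Quotient.exists_rep d
  obtain ⟨Δ, rfl⟩ := Quotient.exists_rep e
  obtain ⟨Λ, rfl⟩ := Quotient.exists_rep f
  obtain ⟨x, c, ⟨b, ⟨a, ha, hb⟩, hc⟩, hx⟩ :=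
    hG.exists_ne _ (hG.mul_mem _ (hG.mul_mem _ Γ.2 _ Δ.2) _ Λ.2)
  exact ⟨x, a, b, c, ⟨Γ, rfl, ha⟩, ⟨Δ, rfl, hb⟩, ⟨Λ, rfl, hc⟩, hx⟩

theorem exists_rep_mul_add (d e f : hG.Germ) :
    ∃ x a b c, Rep hG d x a ∧ Rep hG e a b ∧ Rep hG f a c ∧ x ≠ 0 := by
  obtain ⟨Γ, rfl⟩ := Quotient.exists_rep d
  obtain ⟨Δ, rfl⟩ := Quotient.exists_rep e
  obtain ⟨Λ, rfl⟩ := Quotient.exists_rep f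
  obtain ⟨x, _, ⟨b, c, ⟨a, ha, hb⟩, ⟨a', ha', hc⟩, -⟩, hx⟩ :=
    hG.exists_ne _ (hG.add_mem _ (hG.mul_mem _ Γ.2 _ Δ.2) _ (hG.mul_mem _ Γ.2 _ Λ.2))
  obtain rfl := hG.unique Γ.2 ha ha'
  exact ⟨x, a, b, c, ⟨Γ, rfl, ha⟩, ⟨Δ, rfl, hb⟩, ⟨Λ, rfl, hc⟩, hx⟩

/-- A single representative of `f` serves both `a` and `b`, so it is also defined at `a + b`; two
different representatives would not give this. -/
theorem exists_rep_add_mul (d e f : hG.Germ) :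
    ∃ x a b a' b', Rep hG d x a ∧ Rep hG f a a' ∧ Rep hG e x b ∧ Rep hG f b b' ∧
      Rep hG f (a + b) (a' + b') ∧ x ≠ 0 := by
  obtain ⟨Γ, rfl⟩ := Quotient.exists_rep d
  obtain ⟨Δ, rfl⟩ := Quotient.exists_rep e
  obtain ⟨Λ, rfl⟩ := Quotient.exists_rep f
  obtain ⟨x, _, ⟨a', b', ⟨a, ha, ha'⟩, ⟨b, hb, hb'⟩, -⟩, hx⟩ :=
    hG.exists_ne _ (hG.add_mem _ (hG.mul_mem _ Γ.2 _ Λ.2) _ (hG.mul_mem _ Δ.2 _ Λ.2))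
  exact ⟨x, a, b, a', b', ⟨Γ, rfl, ha⟩, ⟨Λ, rfl, ha'⟩, ⟨Δ, rfl, hb⟩, ⟨Λ, rfl, hb'⟩,
    ⟨Λ, rfl, Λ.1.add_mem ha' hb'⟩, hx⟩

theorem Rep.zero_iff {d : hG.Germ} {x y : M} (hd : Rep hG d x y) (hx : x ≠ 0) :
    d = 0 ↔ y = 0 := by
  constructor
  · rintro rfl
    exact hd.unique (rep_zero hG x)
  · rintro rfl
    exact hd.eq (rep_zero hG x) hx

/-- A representative of a nonzero germ is not the zero map, so it is injective and its converse is
again in the system. -/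
theorem exists_inv (d : hG.Germ) (hd : d ≠ 0) : ∃ e : hG.Germ, d * e = 1 := by
  obtain ⟨Γ, rfl⟩ := Quotient.exists_rep d
  obtain ⟨x, y, h, hx⟩ := hG.exists_ne _ Γ.2
  have hΓ : ∀ x, (x, 0) ∈ Γ.1 → x = 0 := by
    refine (hG.zero_or_injective _ Γ.2).resolve_left fun h0 => hd ?_
    have h : Rep hG (Quotient.mk hG.setoid Γ) x y := ⟨Γ, rfl, h⟩
    exact (h.zero_iff hx).2 (h0 x y (by assumption))
  have h1 : Rep hG (Quotient.mk hG.setoid Γ) x y := ⟨Γ, rfl, h⟩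
  have h2 : Rep hG (Quotient.mk hG.setoid ⟨_, hG.inv_mem _ Γ.2 hΓ⟩) y x := ⟨_, rfl, h⟩
  exact ⟨_, (h1.mul h2).eq (rep_one hG x) hx⟩

instance : Ring hG.Germ where
  add_assoc d e f := by
    obtain ⟨x, a, b, c, ha, hb, hc, hx⟩ := exists_rep_add₃ d e f
    exact (add_assoc a b c ▸ (ha.add hb).add hc).eq (ha.add (hb.add hc)) hx
  zero_add d := by
    obtain ⟨x, a, ha, hx⟩ := exists_rep d
    exact (zero_add a ▸ (rep_zero hG x).add ha).eq ha hx
  add_zero d := by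
    obtain ⟨x, a, ha, hx⟩ := exists_rep d
    exact (add_zero a ▸ ha.add (rep_zero hG x)).eq ha hx
  add_comm d e := by
    obtain ⟨x, a, b, ha, hb, hx⟩ := exists_rep_add d e
    exact (add_comm a b ▸ ha.add hb).eq (hb.add ha) hx
  neg_add_cancel d := by
    obtain ⟨x, a, ha, hx⟩ := exists_rep d
    exact (neg_add_cancel a ▸ ha.neg.add ha).eq (rep_zero hG x) hx
  mul_assoc d e f := by
    obtain ⟨x, a, b, c, ha, hb, hc, hx⟩ := exists_rep_mul₃ d e f
    exact ((ha.mul hb).mul hc).eq (ha.mul (hb.mul hc)) hx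
  one_mul d := by
    obtain ⟨x, a, ha, hx⟩ := exists_rep d
    exact ((rep_one hG x).mul ha).eq ha hx
  mul_one d := by
    obtain ⟨x, a, ha, hx⟩ := exists_rep d
    exact (ha.mul (rep_one hG a)).eq ha hx
  zero_mul d := by
    obtain ⟨x, a, b, ha, hb, hx⟩ : ∃ x a b, Rep hG 0 x a ∧ Rep hG d a b ∧ x ≠ 0 := by
      obtain ⟨x, a, b, c, ha, hb, hc, hx⟩ := exists_rep_mul₃ (0 : hG.Germ) d 0
      exact ⟨x, a, b, ha, hb, hx⟩
    obtain rfl := ha.unique (rep_zero hG x)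
    obtain ⟨Γ, rfl, hb⟩ := hb
    obtain rfl := hG.functional _ Γ.2 _ hb
    exact (ha.mul ⟨Γ, rfl, hb⟩).eq ha hx
  mul_zero d := by
    obtain ⟨x, a, ha, hx⟩ := exists_rep d
    exact (ha.mul (rep_zero hG a)).eq (rep_zero hG x) hx
  left_distrib d e f := by
    obtain ⟨x, a, b, c, ha, hb, hc, hx⟩ := exists_rep_mul_add d e f
    exact (ha.mul (hb.add hc)).eq ((ha.mul hb).add (ha.mul hc)) hx
  right_distrib d e f := by
    obtain ⟨x, a, b, a', b', ha, ha', hb, hb', h, hx⟩ := exists_rep_add_mul d e f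
    exact ((ha.add hb).mul h).eq ((ha.mul ha').add (hb.mul hb')) hx
  nsmul := nsmulRec
  zsmul := zsmulRec

instance : Nontrivial hG.Germ := by
  obtain ⟨x, -, -, hx⟩ := exists_rep (0 : hG.Germ)
  exact ⟨1, 0, fun h => hx (((rep_one hG x).zero_iff hx).1 h)⟩

theorem isUnit_of_ne_zero (d : hG.Germ) (hd : d ≠ 0) : IsUnit d := by
  obtain ⟨e, he⟩ := exists_inv d hd
  have he0 : e ≠ 0 := by
    rintro rfl
    simp at he
  obtain ⟨f, hf⟩ := exists_inv e he0
  have : d = f := by rw [← mul_one d, ← hf, ← mul_assoc, he, one_mul]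
  subst this
  exact ⟨⟨d, e, he, hf⟩, rfl⟩

noncomputable instance : DivisionRing hG.Germ :=
  DivisionRing.ofIsUnitOrEqZero fun d => (em (d = 0)).symm.imp_left (isUnit_of_ne_zero d)

theorem Rep.sum {ι : Type*} (s : Finset ι) {d : ι → hG.Germ} {x : M} {y : ι → M}
    (h : ∀ i, Rep hG (d i) x (y i)) : Rep hG (∑ i ∈ s, d i) x (∑ i ∈ s, y i) := by
  classical
  induction s using Finset.induction_on with
  | empty => simpa using rep_zero hG x
  | insert i s hi ih => simpa [Finset.sum_insert hi] using (h i).add ih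

end Germ

end IsGermSystem

end Graphs

/-! ### Kernels of matrices and the germ system they produce. -/

section ColumnMaps

variable {R : Type*} [Ring R] {M : Type*} [AddCommGroup M] [Module Rᵐᵒᵖ M]
variable {ι κ ι' κ' : Type}

theorem comp_symm_eq_zero (e : ι ≃ ι') {x : ι → M} : x ∘ e.symm = 0 ↔ x = 0 := by
  constructor
  · intro h
    ext i
    simpa using congrFun h (e i)
  · rintro rfl
    rfl

variable [Fintype ι] [Fintype ι']

variable (M) in
/-- The map `M ^ ι → M` induced by a column vector indexed by `ι`. -/
def colMap (c : ι → R) : (ι → M) →+ M where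
  toFun x := ∑ i, MulOpposite.op (c i) • x i
  map_zero' := by simp
  map_add' x y := by simp [smul_add, Finset.sum_add_distrib]

theorem colMap_apply (c : ι → R) (x : ι → M) :
    colMap M c x = ∑ i, MulOpposite.op (c i) • x i := rfl

variable (M) in
/-- The kernel of the action of a matrix on row vectors over `M`. -/
def matKer (C : Matrix ι κ R) : AddSubgroup (ι → M) :=
  ⨅ j, (colMap M (fun i => C i j)).ker

theorem mem_matKer {C : Matrix ι κ R} {x : ι → M} :
    x ∈ matKer M C ↔ ∀ j, colMap M (fun i => C i j) x = 0 := by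
  simp [matKer, AddSubgroup.mem_iInf]

theorem matKer_eq_ker {n m : ℕ} (C : Matrix (Fin n) (Fin m) R) :
    matKer M C = (matAct M C).ker := by
  ext x
  rw [mem_matKer, AddMonoidHom.mem_ker, funext_iff]
  rfl

theorem matAct_injective_iff {n m : ℕ} (C : Matrix (Fin n) (Fin m) R) :
    Function.Injective (matAct M C) ↔ ∀ x ∈ matKer M C, x = 0 := by
  rw [matKer_eq_ker, injective_iff_map_eq_zero]
  rfl

theorem colMap_add (c d : ι → R) (x : ι → M) :
    colMap M (c + d) x = colMap M c x + colMap M d x := by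
  simp [colMap_apply, add_smul, Finset.sum_add_distrib]

theorem colMap_neg (c : ι → R) (x : ι → M) : colMap M (-c) x = -colMap M c x := by
  simp [colMap_apply]

theorem colMap_zero (x : ι → M) : colMap M (0 : ι → R) x = 0 := by
  simp [colMap_apply]

theorem colMap_single [DecidableEq ι] (i : ι) (x : ι → M) :
    colMap M (Pi.single i (1 : R)) x = x i := by
  rw [colMap_apply, Finset.sum_eq_single i]
  · simp
  · intro j _ hj
    simp [hj]
  · simp

theorem colMap_sumElim (c : ι → R) (d : ι' → R) (x : ι → M) (y : ι' → M) :
    colMap M (Sum.elim c d) (Sum.elim x y) = colMap M c x + colMap M d y := by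
  simp [colMap_apply, Fintype.sum_sum_type]

theorem colMap_reindex (e : ι ≃ ι') (c : ι → R) (x : ι → M) :
    colMap M (c ∘ e.symm) (x ∘ e.symm) = colMap M c x := by
  simp only [colMap_apply, Function.comp]
  exact e.symm.sum_comp fun i => MulOpposite.op (c i) • x i

theorem reindex_mem_matKer (e : ι ≃ ι') (f : κ ≃ κ') (C : Matrix ι κ R) {x : ι → M} :
    x ∘ e.symm ∈ matKer M (C.submatrix e.symm f.symm) ↔ x ∈ matKer M C := by
  rw [mem_matKer, mem_matKer, f.symm.forall_congr_left]
  refine forall_congr' fun j => ?_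
  rw [← colMap_reindex e]
  simp [Function.comp_def]

/-- The matrix whose kernel is the pullback of the kernels of `C` and `C'` along the columns
`w` and `-w'`. -/
def pullbackMatrix (C : Matrix ι κ R) (C' : Matrix ι' κ' R) (w : ι → R) (w' : ι' → R) :
    Matrix (ι ⊕ ι') ((κ ⊕ κ') ⊕ Unit) R :=
  Matrix.of fun i => Sum.elim (fun j => Matrix.fromBlocks C 0 0 C' i j)
    fun _ => Sum.elim w w' i

theorem mem_matKer_pullbackMatrix {C : Matrix ι κ R} {C' : Matrix ι' κ' R} {w : ι → R}
    {w' : ι' → R} {x : ι → M} {y : ι' → M} :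
    Sum.elim x y ∈ matKer M (pullbackMatrix C C' w w') ↔
      x ∈ matKer M C ∧ y ∈ matKer M C' ∧ colMap M w x + colMap M w' y = 0 := by
  simp only [mem_matKer, Sum.forall, and_assoc]
  refine and_congr (forall_congr' fun j => ?_) (and_congr (forall_congr' fun j => ?_) ?_)
  · simp [colMap_apply, pullbackMatrix, Fintype.sum_sum_type]
  · simp [colMap_apply, pullbackMatrix, Fintype.sum_sum_type]
  · simp [colMap_apply, pullbackMatrix, Fintype.sum_sum_type]

theorem NoInjectiveTall.exists_ne (h : NoInjectiveTall R M) [Fintype κ]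
    (hc : Fintype.card ι = Fintype.card κ + 1) (C : Matrix ι κ R) :
    ∃ x ∈ matKer M C, x ≠ 0 := by
  let e := Fintype.equivFinOfCardEq hc
  let f := Fintype.equivFin κ
  have := h _ (C.submatrix e.symm f.symm)
  rw [matAct_injective_iff] at this
  push Not at this
  obtain ⟨x, hx, hx0⟩ := this
  obtain ⟨x, rfl⟩ : ∃ y : ι → M, x = y ∘ e.symm := ⟨x ∘ e, by ext; simp⟩
  exact ⟨x, (reindex_mem_matKer e f C).1 hx, fun h => hx0 ((comp_symm_eq_zero e).2 h)⟩

/-- Injectivity on a subgroup is triviality of the kernel. General index types are needed for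
pullbacks (sum types) and for deleted columns (subtypes). -/
theorem KernelDichotomy.dichotomy (h : KernelDichotomy R M) [Fintype κ]
    (hc : Fintype.card ι = Fintype.card κ + 1) (C : Matrix ι κ R) :
    (∀ c : ι → R, (∀ x ∈ matKer M C, colMap M c x = 0) ∨
      ∀ x ∈ matKer M C, colMap M c x = 0 → x = 0) ∨
    ∀ c : ι → R, ∃ x ∈ matKer M C, colMap M c x = 0 ∧ x ≠ 0 := by
  let e := Fintype.equivFinOfCardEq hc
  let f := Fintype.equivFin κ
  have key : ∀ c : ι → R, Set.InjOn (colAct M (c ∘ e.symm))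
      ((matAct M (C.submatrix e.symm f.symm)).ker : Set (Fin (Fintype.card κ + 1) → M)) ↔
      ∀ x ∈ matKer M C, colMap M c x = 0 → x = 0 := by
    intro c
    rw [← matKer_eq_ker]
    constructor
    · intro hi x hx hx0
      rw [← reindex_mem_matKer e f] at hx
      rw [← comp_symm_eq_zero e]
      refine hi hx (AddSubgroup.zero_mem _) ?_
      rw [map_zero, ← hx0]
      exact colMap_reindex e c x
    · intro hi x hx y hy hxy
      obtain ⟨x, rfl⟩ : ∃ y : ι → M, x = y ∘ e.symm := ⟨x ∘ e, by ext; simp⟩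
      obtain ⟨y, rfl⟩ : ∃ z : ι → M, y = z ∘ e.symm := ⟨y ∘ e, by ext; simp⟩
      have hx := (reindex_mem_matKer e f C).1 hx
      have hy := (reindex_mem_matKer e f C).1 hy
      rw [sub_eq_zero.1 (hi _ (sub_mem hx hy) ?_)]
      rw [map_sub, ← colMap_reindex e, ← colMap_reindex e c y]
      exact sub_eq_zero.2 hxy
  rcases h _ (C.submatrix e.symm f.symm) _ rfl with h | h
  · refine Or.inl fun c => or_iff_not_imp_left.2 fun hne => (key c).1 (h _ ?_)
    push Not at hne
    obtain ⟨x, hx, hx0⟩ := hne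
    refine ⟨x ∘ e.symm, ?_, ?_⟩
    · rw [← matKer_eq_ker]
      exact (reindex_mem_matKer e f C).2 hx
    · rw [← colMap_reindex e] at hx0
      exact hx0
  · refine Or.inr fun c => ?_
    have := mt (key c).2 (h _)
    push Not at this
    exact this

/-- The column `v` rules out alternative (b), so (a) holds. -/
theorem KernelDichotomy.zero_or_injective (h : KernelDichotomy R M) [Fintype κ]
    (hc : Fintype.card ι = Fintype.card κ + 1) {C : Matrix ι κ R} {v : ι → R}
    (hv : ∀ x ∈ matKer M C, colMap M v x = 0 → x = 0) (c : ι → R) :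
    (∀ x ∈ matKer M C, colMap M c x = 0) ∨
      ∀ x ∈ matKer M C, colMap M c x = 0 → x = 0 := by
  rcases h.dichotomy hc C with h | h
  · exact h c
  · obtain ⟨x, hx, hx0, hne⟩ := h v
    exact absurd (hv x hx hx0) hne

variable (M) in
/-- The graph of the relation between `x v` and `x c` for `x` in the kernel of `C`. -/
def kerGraph (C : Matrix ι κ R) (v c : ι → R) : AddSubgroup (M × M) :=
  (matKer M C).map ((colMap M v).prod (colMap M c))

theorem mem_kerGraph {C : Matrix ι κ R} {v c : ι → R} {a b : M} :
    (a, b) ∈ kerGraph M C v c ↔ ∃ x ∈ matKer M C, colMap M v x = a ∧ colMap M c x = b := by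
  simp [kerGraph, AddSubgroup.mem_map]

variable (R M) in
/-- The graphs `kerGraph M C v c` with `C` of size `n × (n - 1)` and `v` injective on the kernel
of `C`. -/
def kerGraphs : Set (AddSubgroup (M × M)) :=
  {Γ | ∃ (k : ℕ) (C : Matrix (Fin (k + 1)) (Fin k) R) (v c : Fin (k + 1) → R),
    (∀ x ∈ matKer M C, colMap M v x = 0 → x = 0) ∧ kerGraph M C v c = Γ}

theorem kerGraph_mem_kerGraphs [Fintype κ] (hc : Fintype.card ι = Fintype.card κ + 1)
    {C : Matrix ι κ R} {v : ι → R} (hv : ∀ x ∈ matKer M C, colMap M v x = 0 → x = 0)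
    (c : ι → R) : kerGraph M C v c ∈ kerGraphs R M := by
  let e := Fintype.equivFinOfCardEq hc
  let f := Fintype.equivFin κ
  refine ⟨_, C.submatrix e.symm f.symm, v ∘ e.symm, c ∘ e.symm, fun x hx hx0 => ?_, ?_⟩
  · obtain ⟨x, rfl⟩ : ∃ y : ι → M, x = y ∘ e.symm := ⟨x ∘ e, by ext; simp⟩
    rw [colMap_reindex] at hx0
    rw [comp_symm_eq_zero]
    exact hv x ((reindex_mem_matKer e f C).1 hx) hx0
  · ext ⟨a, b⟩
    rw [mem_kerGraph, mem_kerGraph]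
    constructor
    · rintro ⟨x, hx, h⟩
      obtain ⟨x, rfl⟩ : ∃ y : ι → M, x = y ∘ e.symm := ⟨x ∘ e, by ext; simp⟩
      rw [colMap_reindex, colMap_reindex] at h
      exact ⟨x, (reindex_mem_matKer e f C).1 hx, h⟩
    · rintro ⟨x, hx, h⟩
      refine ⟨x ∘ e.symm, (reindex_mem_matKer e f C).2 hx, ?_⟩
      rwa [colMap_reindex, colMap_reindex]

theorem graphHom_colMap_mem_kerGraphs (r : R) (f : M →+ M)
    (hf : ∀ x, f x = MulOpposite.op r • x) : graphHom f ∈ kerGraphs R M := by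
  -- The kernel of a `1 × 0` matrix is all of `M`.
  refine ⟨0, 0, fun _ => 1, fun _ => r, fun x _ hx => ?_, ?_⟩
  · ext i
    rw [Fin.fin_one_eq_zero i]
    simpa [colMap_apply] using hx
  · ext ⟨a, b⟩
    rw [mem_kerGraph]
    constructor
    · rintro ⟨x, -, rfl, rfl⟩
      simp [graphHom, colMap_apply, hf]
    · intro h
      change b = f a at h
      exact ⟨fun _ => a, mem_matKer.2 fun j => j.elim0, by simp [colMap_apply],
        by simp [colMap_apply, h, hf]⟩

theorem kerGraphs_add_mem {Γ Δ : AddSubgroup (M × M)} (hΓ : Γ ∈ kerGraphs R M)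
    (hΔ : Δ ∈ kerGraphs R M) : graphAdd Γ Δ ∈ kerGraphs R M := by
  obtain ⟨k, C, v, c, hv, rfl⟩ := hΓ
  obtain ⟨l, C', v', c', hv', rfl⟩ := hΔ
  -- The pullback consists of the pairs with `x v = x' v'`, a common point of the two domains. It is
  -- cut out by `k + l + 1` columns on `(k + 1) + (l + 1)` rows, again one column fewer than rows.
  convert kerGraph_mem_kerGraphs (C := pullbackMatrix C C' v (-v'))
    (v := Sum.elim v 0) (by simp; omega) (fun z hz hz0 => ?_) (Sum.elim c c') using 1
  · ext ⟨a, b⟩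
    rw [mem_kerGraph]
    constructor
    · rintro ⟨y, z, hy, hz, h⟩
      obtain ⟨x, hx, hxa, rfl⟩ := mem_kerGraph.1 hy
      obtain ⟨x', hx', hxa', rfl⟩ := mem_kerGraph.1 hz
      refine ⟨Sum.elim x x', mem_matKer_pullbackMatrix.2 ⟨hx, hx', ?_⟩, ?_, ?_⟩
      · rw [hxa, colMap_neg, hxa', add_neg_cancel]
      · rw [colMap_sumElim, colMap_zero, add_zero, hxa]
      · rw [colMap_sumElim]
        exact h
    · rintro ⟨z, hz, h, h'⟩
      obtain ⟨x, y, rfl⟩ : ∃ x y, z = Sum.elim x y := ⟨_, _, (Sum.elim_comp_inl_inr z).symm⟩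
      obtain ⟨hx, hy, hxy⟩ := mem_matKer_pullbackMatrix.1 hz
      rw [colMap_sumElim, colMap_zero, add_zero] at h
      rw [colMap_sumElim] at h'
      rw [colMap_neg, add_neg_eq_zero] at hxy
      exact ⟨_, _, mem_kerGraph.2 ⟨x, hx, h, rfl⟩,
        mem_kerGraph.2 ⟨y, hy, hxy.symm.trans h, rfl⟩, h'⟩
  · obtain ⟨x, y, rfl⟩ : ∃ x y, z = Sum.elim x y := ⟨_, _, (Sum.elim_comp_inl_inr z).symm⟩
    obtain ⟨hx, hy, hxy⟩ := mem_matKer_pullbackMatrix.1 hz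
    rw [colMap_sumElim, colMap_zero, add_zero] at hz0
    rw [hz0, zero_add, colMap_neg, neg_eq_zero] at hxy
    rw [hv x hx hz0, hv' y hy hxy]
    exact Sum.elim_zero_zero

theorem kerGraphs_mul_mem {Γ Δ : AddSubgroup (M × M)} (hΓ : Γ ∈ kerGraphs R M)
    (hΔ : Δ ∈ kerGraphs R M) : graphMul Γ Δ ∈ kerGraphs R M := by
  obtain ⟨k, C, v, c, hv, rfl⟩ := hΓ
  obtain ⟨l, C', v', c', hv', rfl⟩ := hΔ
  -- Here the pairs satisfy `x c = x' v'`: the value of the first map is the argument of the second.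
  convert kerGraph_mem_kerGraphs (C := pullbackMatrix C C' c (-v'))
    (v := Sum.elim v 0) (by simp; omega) (fun z hz hz0 => ?_) (Sum.elim 0 c') using 1
  · ext ⟨a, b⟩
    rw [mem_kerGraph]
    constructor
    · rintro ⟨y, hy, hz⟩
      obtain ⟨x, hx, hxa, hxy⟩ := mem_kerGraph.1 hy
      obtain ⟨x', hx', hxa', hxb⟩ := mem_kerGraph.1 hz
      refine ⟨Sum.elim x x', mem_matKer_pullbackMatrix.2 ⟨hx, hx', ?_⟩, ?_, ?_⟩
      · rw [hxy, colMap_neg, hxa', add_neg_cancel]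
      · rw [colMap_sumElim, colMap_zero, add_zero, hxa]
      · rw [colMap_sumElim, colMap_zero, zero_add, hxb]
    · rintro ⟨z, hz, h, h'⟩
      obtain ⟨x, y, rfl⟩ : ∃ x y, z = Sum.elim x y := ⟨_, _, (Sum.elim_comp_inl_inr z).symm⟩
      obtain ⟨hx, hy, hxy⟩ := mem_matKer_pullbackMatrix.1 hz
      rw [colMap_sumElim, colMap_zero, add_zero] at h
      rw [colMap_sumElim, colMap_zero, zero_add] at h'
      rw [colMap_neg, add_neg_eq_zero] at hxy
      exact ⟨_, mem_kerGraph.2 ⟨x, hx, h, rfl⟩, mem_kerGraph.2 ⟨y, hy, hxy.symm, h'⟩⟩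
  · obtain ⟨x, y, rfl⟩ : ∃ x y, z = Sum.elim x y := ⟨_, _, (Sum.elim_comp_inl_inr z).symm⟩
    obtain ⟨hx, hy, hxy⟩ := mem_matKer_pullbackMatrix.1 hz
    rw [colMap_sumElim, colMap_zero, add_zero] at hz0
    obtain rfl := hv x hx hz0
    rw [map_zero, zero_add, colMap_neg, neg_eq_zero] at hxy
    rw [hv' y hy hxy]
    exact Sum.elim_zero_zero

theorem isGermSystem_kerGraphs (h₁ : NoInjectiveTall R M) (h₂ : KernelDichotomy R M) :
    IsGermSystem (kerGraphs R M) where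
  exists_ne := by
    rintro _ ⟨k, C, v, c, hv, rfl⟩
    obtain ⟨x, hx, hne⟩ := h₁.exists_ne (by simp) C
    exact ⟨_, _, mem_kerGraph.2 ⟨x, hx, rfl, rfl⟩, mt (hv x hx) hne⟩
  functional := by
    rintro _ ⟨k, C, v, c, hv, rfl⟩ y hy
    obtain ⟨x, hx, hx0, rfl⟩ := mem_kerGraph.1 hy
    rw [hv x hx hx0, map_zero]
  zero_or_injective := by
    rintro _ ⟨k, C, v, c, hv, rfl⟩
    refine (h₂.zero_or_injective (by simp) hv c).imp (fun h x y hxy => ?_) fun h x hx => ?_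
    · obtain ⟨x, hx, -, rfl⟩ := mem_kerGraph.1 hxy
      exact h x hx
    · obtain ⟨y, hy, rfl, hy0⟩ := mem_kerGraph.1 hx
      rw [h y hy hy0, map_zero]
  add_mem _ hΓ _ hΔ := kerGraphs_add_mem hΓ hΔ
  mul_mem _ hΓ _ hΔ := kerGraphs_mul_mem hΓ hΔ
  neg_mem := by
    rintro _ ⟨k, C, v, c, hv, rfl⟩
    refine ⟨k, C, v, -c, hv, ?_⟩
    ext ⟨a, b⟩
    change _ ↔ (a, -b) ∈ kerGraph M C v c
    simp only [mem_kerGraph, colMap_neg, neg_eq_iff_eq_neg]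
  inv_mem := by
    rintro _ ⟨k, C, v, c, hv, rfl⟩ h
    refine ⟨k, C, c, v, fun x hx hx0 => hv x hx ?_, ?_⟩
    · exact h _ (mem_kerGraph.2 ⟨x, hx, rfl, hx0⟩)
    · ext ⟨a, b⟩
      change _ ↔ (b, a) ∈ kerGraph M C v c
      simp only [mem_kerGraph, and_comm]
  zero_mem := graphHom_colMap_mem_kerGraphs (0 : R) _ (by simp)
  one_mem := graphHom_colMap_mem_kerGraphs (1 : R) _ (by simp)

end ColumnMaps

/-- The matrix `A` without its `j`-th column. -/
def eraseCol {R ι κ : Type*} (A : Matrix ι κ R) (j : κ) : Matrix ι {i // i ≠ j} R :=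
  A.submatrix id Subtype.val

theorem eraseCol_congr {R ι κ : Type*} {A B : Matrix ι κ R} {j : κ}
    (h : ∀ i l, l ≠ j → A i l = B i l) : eraseCol A j = eraseCol B j := by
  ext i l
  exact h i l l.2

/-! ### Singularity over the germs. -/

section Germs

open IsGermSystem IsGermSystem.Germ

variable {R : Type*} [Ring R] {M : Type*} [AddCommGroup M] [Module Rᵐᵒᵖ M]
variable (hG : IsGermSystem (kerGraphs R M))

/-- The germ of the action of a ring element on the module. -/
def toGerm : R →+* hG.Germ where
  toFun r := Quotient.mk hG.setoid ⟨graphHom (DistribSMul.toAddMonoidHom M (MulOpposite.op r)),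
    graphHom_colMap_mem_kerGraphs r _ fun _ => rfl⟩
  map_one' := Quotient.sound (s := hG.setoid) fun x y z (hy : y = MulOpposite.op (1 : R) • x)
      (hz : z = x) => by
    rw [hy, hz, MulOpposite.op_one, one_smul]
  map_zero' := Quotient.sound (s := hG.setoid) fun x y z (hy : y = MulOpposite.op (0 : R) • x)
      (hz : z = 0) => by
    rw [hy, hz, MulOpposite.op_zero, zero_smul]
  map_mul' r s := Quotient.sound (s := hG.setoid) fun x y z
      (hy : y = MulOpposite.op (r * s) • x) hz => by
    obtain ⟨t, ht, hz⟩ := hz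
    change t = MulOpposite.op r • x at ht
    change z = MulOpposite.op s • t at hz
    rw [hy, hz, ht, MulOpposite.op_mul, mul_smul]
  map_add' r s := Quotient.sound (s := hG.setoid) fun x y z
      (hy : y = MulOpposite.op (r + s) • x) hz => by
    obtain ⟨a, b, ha, hb, hz⟩ := hz
    change a = MulOpposite.op r • x at ha
    change b = MulOpposite.op s • x at hb
    change a + b = z at hz
    rw [hy, ← hz, ha, hb, MulOpposite.op_add, add_smul]

theorem rep_toGerm (r : R) (x : M) : Rep hG (toGerm hG r) x (MulOpposite.op r • x) :=
  ⟨_, rfl, rfl⟩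

theorem toGerm_injective [FaithfulSMul Rᵐᵒᵖ M] : Function.Injective (toGerm hG) := by
  intro r s h
  refine MulOpposite.op_injective (FaithfulSMul.eq_of_smul_eq_smul (α := M) fun x => ?_)
  exact (rep_toGerm hG r x).unique (h ▸ rep_toGerm hG s x)

variable {ι κ : Type} [Fintype ι]

/-- Take `d l` to be the germ of `x v ↦ x l`. Following it by the action of `c l` and summing over
`l` sends `x v` to `x c`. -/
theorem exists_germ_row [Fintype κ] (hc : Fintype.card ι = Fintype.card κ + 1) {C : Matrix ι κ R}
    {v : ι → R} (hv : ∀ x ∈ matKer M C, colMap M v x = 0 → x = 0) :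
    ∃ d : ι → hG.Germ, ∀ x ∈ matKer M C, ∀ c : ι → R,
      Rep hG (∑ l, d l * toGerm hG (c l)) (colMap M v x) (colMap M c x) := by
  classical
  refine ⟨fun l => Quotient.mk hG.setoid
    ⟨_, kerGraph_mem_kerGraphs hc hv (Pi.single l 1)⟩, fun x hx c => ?_⟩
  refine Rep.sum _ fun l => Rep.mul (y := x l) ⟨_, rfl, ?_⟩ (rep_toGerm hG _ _)
  exact mem_kerGraph.2 ⟨x, hx, rfl, colMap_single l x⟩

theorem mem_matKer_iff_eraseCol {A : Matrix ι κ R} (j : κ) {x : ι → M} :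
    x ∈ matKer M A ↔ x ∈ matKer M (eraseCol A j) ∧ colMap M (fun i => A i j) x = 0 := by
  simp only [mem_matKer]
  refine ⟨fun h => ⟨fun i => h i, h j⟩, fun h i => ?_⟩
  rcases eq_or_ne i j with rfl | hi
  · exact h.2
  · exact h.1 ⟨i, hi⟩

theorem card_eq_card_ne_add_one [DecidableEq ι] (j : ι) :
    Fintype.card ι = Fintype.card {i // i ≠ j} + 1 := by
  have := Fintype.card_pos_iff.2 ⟨j⟩
  rw [Fintype.card_subtype_compl, Fintype.card_subtype_eq]
  omega

/-- A matrix acting injectively on row vectors has a left inverse `d` over the germs. -/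
theorem exists_germ_leftInverse [DecidableEq ι] {A : Matrix ι ι R}
    (hR : NoInjectiveTall R M) (hA : ∀ x ∈ matKer M A, x = 0) :
    ∃ d : Matrix ι ι hG.Germ, d * A.map (toGerm hG) = 1 ∧
      ∀ j (c : ι → R), (∃ x ∈ matKer M (eraseCol A j), colMap M c x = 0 ∧ x ≠ 0) →
        ∑ l, d j l * toGerm hG (c l) = 0 := by
  have hv : ∀ j, ∀ x ∈ matKer M (eraseCol A j), colMap M (fun i => A i j) x = 0 → x = 0 :=
    fun j x hx hx0 => hA x ((mem_matKer_iff_eraseCol j).2 ⟨hx, hx0⟩)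
  -- Row `j` is attached to the kernel left after deleting column `j`, with that column in the role
  -- of `v`. It sends column `j` to `1`, and it sends to `0` every column vanishing at some nonzero
  -- point of the kernel, in particular the other columns of `A`.
  obtain ⟨d, hd⟩ : ∃ d : Matrix ι ι hG.Germ, ∀ j, ∀ x ∈ matKer M (eraseCol A j),
      ∀ c : ι → R, Rep hG (∑ l, d j l * toGerm hG (c l)) (colMap M (fun i => A i j) x)
        (colMap M c x) :=
    Classical.axiomOfChoice
      fun j => exists_germ_row hG (card_eq_card_ne_add_one j) (hv j)
  have h0 : ∀ j (c : ι → R), (∃ x ∈ matKer M (eraseCol A j), colMap M c x = 0 ∧ x ≠ 0) →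
      ∑ l, d j l * toGerm hG (c l) = 0 := by
    rintro j c ⟨x, hx, hx0, hne⟩
    exact ((hd j x hx c).zero_iff (mt (hv j x hx) hne)).2 hx0
  refine ⟨d, ?_, h0⟩
  ext j l
  rw [Matrix.mul_apply]
  obtain ⟨x, hx, hne⟩ := hR.exists_ne (card_eq_card_ne_add_one j) (eraseCol A j)
  rcases eq_or_ne j l with rfl | hjl
  · rw [Matrix.one_apply_eq]
    exact (hd j x hx _).eq (rep_one hG _) (mt (hv j x hx) hne)
  · rw [Matrix.one_apply_ne hjl]
    exact h0 j _ ⟨x, hx, mem_matKer.1 hx ⟨l, hjl.symm⟩, hne⟩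

/-- If the columns of `A` are right independent over the germs, then any set of them can be
exchanged for columns of the identity matrix to give a matrix acting injectively on row vectors. -/
theorem exists_exchange [DecidableEq ι] {A : Matrix ι ι R} (hR : NoInjectiveTall R M)
    (hA : ∀ y : ι → hG.Germ, (A.map (toGerm hG)).mulVec y = 0 → y = 0) (s : Finset ι) :
    ∃ (B : Matrix ι ι R) (σ : ι → ι), (∀ x ∈ matKer M B, x = 0) ∧ Set.InjOn σ s ∧
      ∀ i ∈ s, ∀ l, B l (σ i) = A l i := by
  induction s using Finset.induction_on with
  | empty =>
    refine ⟨1, id, fun x hx => ?_, by simp, by simp⟩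
    ext j
    have := mem_matKer.1 hx j
    rw [show (fun i => (1 : Matrix ι ι R) i j) = Pi.single j 1 from ?_, colMap_single] at this
    · exact this
    · ext i
      simp [Matrix.one_apply, Pi.single_apply]
  | insert k s hk ih =>
    obtain ⟨B, σ, hB, hσ, hBA⟩ := ih
    -- Either some column of `B` not yet taken from `A` can be replaced by column `k` of `A` with
    -- injectivity kept, or none can.
    by_cases h : ∃ j ∉ σ '' s,
        ∀ x ∈ matKer M (eraseCol B j), colMap M (fun l => A l k) x = 0 → x = 0
    · obtain ⟨j, hj, hx⟩ := h
      have hne : ∀ i ∈ s, i ≠ k := by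
        rintro i hi rfl
        exact hk hi
      refine ⟨B.updateCol j fun l => A l k, Function.update σ k j, fun x hxB => ?_, ?_, ?_⟩
      · obtain ⟨h1, h2⟩ := (mem_matKer_iff_eraseCol j).1 hxB
        refine hx x ?_ (by simpa using h2)
        rwa [eraseCol_congr (B := B) fun i l hl => Matrix.updateCol_ne hl] at h1
      · rw [Finset.coe_insert, Set.injOn_insert (by simpa using hk)]
        refine ⟨fun a ha b hb hab => ?_, ?_⟩
        · rw [Function.update_of_ne (hne a ha), Function.update_of_ne (hne b hb)] at hab
          exact hσ ha hb hab
        · rintro ⟨i, hi, h⟩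
          rw [Function.update_self, Function.update_of_ne (hne i hi)] at h
          exact hj ⟨i, hi, h⟩
      · intro i hi l
        rcases Finset.mem_insert.1 hi with rfl | hi
        · simp
        · rw [Function.update_of_ne (hne i hi), Matrix.updateCol_ne, hBA i hi]
          rintro rfl
          exact hj ⟨i, hi, rfl⟩
    · push Not at h
      obtain ⟨d, hd, h0⟩ := exists_germ_leftInverse hG hR hB
      -- Over a division ring a one-sided inverse of a square matrix is two-sided, so `w` gives the
      -- coordinates of column `k` of `A` in the columns of `B`.
      have hd' := mul_eq_one_comm.1 hd
      let w : ι → hG.Germ := d.mulVec fun l => toGerm hG (A l k)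
      have hw0 : ∀ j ∉ σ '' s, w j = 0 := fun j hj => h0 j _ (h j hj)
      have hw : (B.map (toGerm hG)).mulVec w = fun l => toGerm hG (A l k) := by
        rw [Matrix.mulVec_mulVec, hd', Matrix.one_mulVec]
      -- As `w` vanishes off `σ '' s`, column `k` of `A` is a combination of the columns of `A` in
      -- `s`; `y` is the resulting forbidden dependence.
      let y : ι → hG.Germ := fun i => if i ∈ s then -w (σ i) else if i = k then 1 else 0
      have hy : (A.map (toGerm hG)).mulVec y = 0 := by
        ext l
        have h1 := congrFun hw l
        simp only [Matrix.mulVec, dotProduct, Matrix.map_apply] at h1 ⊢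
        have h2 : ∑ j, toGerm hG (B l j) * w j = ∑ i ∈ s, toGerm hG (A l i) * w (σ i) := by
          rw [← Finset.sum_subset (Finset.subset_univ (s.image σ)), Finset.sum_image hσ]
          · exact Finset.sum_congr rfl fun i hi => by rw [hBA i hi]
          · intro j _ hj
            rw [hw0 j (by simpa using hj), mul_zero]
        rw [h2] at h1
        rw [← Finset.sum_subset (Finset.subset_univ (insert k s)), Finset.sum_insert hk,
          Pi.zero_apply]
        · have h3 : ∑ i ∈ s, toGerm hG (A l i) * y i =
              -∑ i ∈ s, toGerm hG (A l i) * w (σ i) := by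
            rw [← Finset.sum_neg_distrib]
            exact Finset.sum_congr rfl fun i hi => by simp [y, hi]
          rw [h3, h1]
          simp [y, hk]
        · intro i _ hi
          rw [Finset.mem_insert, not_or] at hi
          simp [y, hi.1, hi.2]
      have := congrFun (hA y hy) k
      simp [y, hk] at this

theorem mem_nonInjective {n : ℕ} {A : Matrix (Fin n) (Fin n) R} :
    A ∈ nonInjective M n ↔ ∃ x ∈ matKer M A, x ≠ 0 := by
  rw [nonInjective, Set.mem_ofPred_eq, matAct_injective_iff]
  push Not
  rfl

/-- A matrix acts non-injectively if and only if it is singular over the germs. -/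
theorem mem_nonInjective_iff_singular (hR : NoInjectiveTall R M) {n : ℕ}
    {A : Matrix (Fin n) (Fin n) R} :
    A ∈ nonInjective M n ↔
      ∃ y : Fin n → hG.Germ, (A.map (toGerm hG)).mulVec y = 0 ∧ y ≠ 0 := by
  constructor
  · intro h
    by_contra! hA
    -- Once every column is exchanged, `B` is `A` with its columns permuted, so `A` acts injectively
    -- too.
    obtain ⟨B, σ, hB, hσ, hBA⟩ := exists_exchange hG hR hA Finset.univ
    obtain ⟨x, hx, hne⟩ := mem_nonInjective.1 h
    refine hne (hB x (mem_matKer.2 fun j => ?_))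
    have hσ' : Function.Surjective σ := Finite.surjective_of_injective (by simpa using hσ)
    obtain ⟨i, rfl⟩ := hσ' j
    simpa only [hBA i (Finset.mem_univ i)] using mem_matKer.1 hx i
  · rintro ⟨y, hy, hne⟩
    rw [mem_nonInjective]
    by_contra! h
    obtain ⟨d, hd, -⟩ := exists_germ_leftInverse hG hR h
    apply hne
    rw [← Matrix.one_mulVec y, ← hd, ← Matrix.mulVec_mulVec, hy, Matrix.mulVec_zero]

end Germs

/-! ### The conditions on the matrices acting non-injectively. -/

section Conditions

variable {R : Type*} [Ring R] {M : Type*} [AddCommGroup M] [Module Rᵐᵒᵖ M]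

/-- Singular matrices over a division ring are closed under row determinantal sums. -/
theorem exists_mulVec_nablaRow_eq_zero {D : Type*} [DivisionRing D] {n : ℕ} {r : Fin n}
    {A B : Matrix (Fin n) (Fin n) D} (h : AgreeOffRow r A B) {y z : Fin n → D}
    (hy : A.mulVec y = 0) (hy0 : y ≠ 0) (hz : B.mulVec z = 0) (hz0 : z ≠ 0) :
    ∃ w, (nablaRow r A B).mulVec w = 0 ∧ w ≠ 0 := by
  have hC : ∀ w, (nablaRow r A B).mulVec w r = A.mulVec w r + B.mulVec w r := by
    intro w
    simp [nablaRow, Matrix.mulVec, dotProduct, add_mul, Finset.sum_add_distrib]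
  have hCA : ∀ w, ∀ i ≠ r, (nablaRow r A B).mulVec w i = A.mulVec w i := by
    intro w i hi
    simp [nablaRow, Matrix.mulVec, dotProduct, Matrix.updateRow_ne hi]
  have hAB : ∀ w, ∀ i ≠ r, A.mulVec w i = B.mulVec w i := by
    intro w i hi
    simp only [Matrix.mulVec, dotProduct, h i _ hi]
  by_cases hβ : B.mulVec y r = 0
  · refine ⟨y, ?_, hy0⟩
    ext i
    rcases eq_or_ne i r with rfl | hi
    · rw [hC, hy, hβ, Pi.zero_apply, add_zero]
    · rw [hCA y i hi, hy]
  by_cases hα : A.mulVec z r = 0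
  · refine ⟨z, ?_, hz0⟩
    ext i
    rcases eq_or_ne i r with rfl | hi
    · rw [hC, hz, hα, Pi.zero_apply, add_zero]
    · rw [hCA z i hi, hAB z i hi, hz]
  -- With `A y = 0` and `B z = 0`, the `r`-th entry of `(A ∇ B) (z - y d)` is `(A z) r - (B y) r *
  -- d`, which this `d` makes zero. If `z = y d`, then `A z = 0`, contrary to `hα`.
  let d := (B.mulVec y r)⁻¹ * A.mulVec z r
  have hsub : ∀ (E : Matrix (Fin n) (Fin n) D) i,
      E.mulVec (fun j => z j - y j * d) i = E.mulVec z i - E.mulVec y i * d := by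
    intro E i
    simp [Matrix.mulVec, dotProduct, mul_sub, Finset.sum_mul, mul_assoc]
  refine ⟨fun j => z j - y j * d, ?_, fun h0 => hα ?_⟩
  · ext i
    rcases eq_or_ne i r with rfl | hi
    · rw [hC, hsub, hsub, hy, hz]
      simp [d, mul_inv_cancel_left₀ hβ]
    · rw [hCA _ i hi, hsub, hAB z i hi, hz, hy]
      simp
  · have := hsub A r
    rw [h0, hy, Matrix.mulVec_zero] at this
    simpa using this.symm

theorem closedNablaRow_nonInjective (h₁ : NoInjectiveTall R M) (h₂ : KernelDichotomy R M) :
    ClosedNablaRow (nonInjective (R := R) M) := by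
  intro n r A B hA hB h
  have hG := isGermSystem_kerGraphs h₁ h₂
  rw [mem_nonInjective_iff_singular hG h₁] at hA hB ⊢
  obtain ⟨y, hy, hy0⟩ := hA
  obtain ⟨z, hz, hz0⟩ := hB
  obtain ⟨w, hw, hw0⟩ := exists_mulVec_nablaRow_eq_zero (r := r)
    (A := A.map (toGerm hG)) (B := B.map (toGerm hG)) (fun i j hi => congrArg (toGerm hG) (h i j hi)) hy hy0 hz hz0
  refine ⟨w, ?_, hw0⟩
  rw [← hw]
  congr 1
  ext i j
  simp only [nablaRow, Matrix.map_apply, Matrix.updateRow_apply]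
  split_ifs <;> simp

theorem closedNablaCol_nonInjective (h : KernelDichotomy R M) :
    ClosedNablaCol (nonInjective (R := R) M) := by
  intro n r A B hA hB hAB
  rw [mem_nonInjective] at hA hB ⊢
  simp only [mem_matKer_iff_eraseCol r] at hA hB ⊢
  have hC : eraseCol (nablaCol r A B) r = eraseCol A r :=
    eraseCol_congr fun i l hl => Matrix.updateCol_ne hl
  have hcol : (fun i => nablaCol r A B i r) = (fun i => A i r) + fun i => B i r := by
    ext i
    simp [nablaCol]
  rw [← eraseCol_congr hAB] at hB
  rw [hC, hcol]
  simp only [and_assoc] at hA hB ⊢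
  -- In case (a) column `r` of `B` is not injective on the common kernel, so it is zero there and
  -- the null vector of `A` serves for the sum. In case (b) no column is injective there, in
  -- particular not the sum.
  rcases h.dichotomy (card_eq_card_ne_add_one r) (eraseCol A r) with hK | hK
  · obtain ⟨x, hx, hxA, hx0⟩ := hA
    obtain ⟨y, hy, hyB, hy0⟩ := hB
    have hBz := (hK fun i => B i r).resolve_right fun hi => hy0 (hi y hy hyB)
    exact ⟨x, hx, by rw [colMap_add, hxA, hBz x hx, add_zero], hx0⟩
  · exact hK _

theorem matAct_apply {n m : ℕ} (A : Matrix (Fin n) (Fin m) R) (x : Fin n → M) (j : Fin m) :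
    matAct M A x j = ∑ i, MulOpposite.op (A i j) • x i := rfl

theorem matAct_mul {n m l : ℕ} (A : Matrix (Fin n) (Fin m) R) (B : Matrix (Fin m) (Fin l) R)
    (x : Fin n → M) : matAct M (A * B) x = matAct M B (matAct M A x) := by
  ext j
  simp only [matAct_apply, Matrix.mul_apply, Finset.smul_sum, Finset.op_sum, Finset.sum_smul,
    MulOpposite.op_mul, mul_smul]
  exact Finset.sum_comm

theorem matAct_one {n : ℕ} (x : Fin n → M) :
    matAct M (1 : Matrix (Fin n) (Fin n) R) x = x := by
  ext j
  rw [matAct_apply, Finset.sum_eq_single j]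
  · simp
  · intro i _ hi
    simp [Matrix.one_apply_ne hi]
  · simp

theorem mem_matKer_diagSum {m n : ℕ} {A : Matrix (Fin m) (Fin m) R}
    {B : Matrix (Fin n) (Fin n) R} {x : Fin m → M} {y : Fin n → M} :
    Sum.elim x y ∘ finSumFinEquiv.symm ∈ matKer M (diagSum A B) ↔
      x ∈ matKer M A ∧ y ∈ matKer M B := by
  rw [diagSum, Matrix.reindex_apply, reindex_mem_matKer]
  simp only [mem_matKer, Sum.forall]
  refine and_congr (forall_congr' fun j => ?_) (forall_congr' fun j => ?_) <;>
  simp [colMap_apply, Fintype.sum_sum_type]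

theorem diagSum_mem_nonInjective_iff {m n : ℕ} {A : Matrix (Fin m) (Fin m) R}
    {B : Matrix (Fin n) (Fin n) R} :
    diagSum A B ∈ nonInjective M (m + n) ↔ A ∈ nonInjective M m ∨ B ∈ nonInjective M n := by
  simp only [mem_nonInjective]
  constructor
  · rintro ⟨z, hz, hz0⟩
    obtain ⟨x, y, rfl⟩ : ∃ (x : Fin m → M) (y : Fin n → M),
        z = Sum.elim x y ∘ finSumFinEquiv.symm := by
      refine ⟨z ∘ finSumFinEquiv ∘ Sum.inl, z ∘ finSumFinEquiv ∘ Sum.inr, ?_⟩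
      rw [← Function.comp_assoc, ← Function.comp_assoc, Sum.elim_comp_inl_inr]
      ext i
      simp
    obtain ⟨hx, hy⟩ := mem_matKer_diagSum.1 hz
    by_contra! h
    rw [h.1 x hx, h.2 y hy, Sum.elim_zero_zero] at hz0
    exact hz0 rfl
  · rintro (⟨x, hx, hx0⟩ | ⟨y, hy, hy0⟩)
    · refine ⟨_, mem_matKer_diagSum.2 ⟨hx, zero_mem _⟩, fun h => hx0 ?_⟩
      rw [comp_symm_eq_zero] at h
      exact congrArg (· ∘ Sum.inl) h
    · refine ⟨_, mem_matKer_diagSum.2 ⟨zero_mem _, hy⟩, fun h => hy0 ?_⟩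
      rw [comp_symm_eq_zero] at h
      exact congrArg (· ∘ Sum.inr) h

theorem one_notMem_nonInjective (n : ℕ) :
    (1 : Matrix (Fin n) (Fin n) R) ∉ nonInjective M n := by
  rw [nonInjective, Set.mem_ofPred_eq, not_not]
  intro x y h
  rwa [matAct_one, matAct_one] at h

/-- Since `z F E = z`, the map `z ↦ z F` is injective, and it carries the action of `A` into that of
`E * A`. -/
theorem mul_mem_nonInjective {n : ℕ} {A E F : Matrix (Fin n) (Fin n) R} (hEF : F * E = 1)
    (hA : A ∈ nonInjective M n) : E * A ∈ nonInjective M n := by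
  intro h
  refine hA fun x y hxy => ?_
  have key : ∀ z : Fin n → M, matAct M (E * A) (matAct M F z) = matAct M A z := by
    intro z
    rw [← matAct_mul, ← mul_assoc, hEF, one_mul]
  have hF := congrArg (matAct M E) (h ((key x).trans (hxy.trans (key y).symm)))
  rwa [← matAct_mul, ← matAct_mul, hEF, matAct_one, matAct_one] at hF

theorem closedElementaryLeft_nonInjective :
    ClosedElementaryLeft (nonInjective (R := R) M) := by
  intro n i j hij A hA
  have h0 : Matrix.single i j (1 : R) * Matrix.single i j 1 = 0 :=
    Matrix.single_mul_single_of_ne _ _ _ _ hij.symm _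
  constructor
  · refine mul_mem_nonInjective (F := 1 - Matrix.single i j 1) ?_ hA
    noncomm_ring
    simp [h0]
  · refine mul_mem_nonInjective (F := 1 + Matrix.single i j 1) ?_ hA
    noncomm_ring
    simp [h0]

theorem containsNonFull_nonInjective_iff :
    ContainsNonFull (nonInjective (R := R) M) ↔ NoInjectiveTall R M := by
  constructor
  · intro h k C hC
    -- The right factor is `(I 0)`, so the product is `C` with a zero column appended; dropping the
    -- last coordinate recovers the action of `C`.
    refine h k (C * (1 : Matrix (Fin (k + 1)) (Fin (k + 1)) R).submatrix Fin.castSucc id)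
      ⟨_, _, rfl⟩ fun x y hxy => hC ?_
    rw [matAct_mul, matAct_mul] at hxy
    have key : ∀ z : Fin k → M, (fun i : Fin k => matAct M
        ((1 : Matrix (Fin (k + 1)) (Fin (k + 1)) R).submatrix Fin.castSucc id) z
          i.castSucc) = z := by
      intro z
      ext j
      rw [matAct_apply, Finset.sum_eq_single j]
      · rw [Matrix.submatrix_apply, id, Matrix.one_apply_eq, MulOpposite.op_one, one_smul]
      · intro i _ hi
        rw [Matrix.submatrix_apply, id, Matrix.one_apply_ne (by simpa using hi),
          MulOpposite.op_zero, zero_smul]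
      · simp
    rw [← key (matAct M C x), ← key (matAct M C y), hxy]
  · rintro h k _ ⟨B, C, rfl⟩ hBC
    refine h k B fun x y hxy => hBC ?_
    rw [matAct_mul, matAct_mul, hxy]

theorem oneNotMem_nonInjective : OneNotMem (nonInjective (R := R) M) :=
  one_notMem_nonInjective 1

theorem isPrimeMatrixIdeal_nonInjective (h₁ : NoInjectiveTall R M) (h₂ : KernelDichotomy R M) :
    IsPrimeMatrixIdeal (nonInjective (R := R) M) where
  containsNonFull := containsNonFull_nonInjective_iff.2 h₁
  closedDiagSum _ _ _ _ hA := diagSum_mem_nonInjective_iff.2 (Or.inl hA)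
  closedNablaCol := closedNablaCol_nonInjective h₂
  closedNablaRow := closedNablaRow_nonInjective h₁ h₂
  cancelsOne _ _ h :=
    (diagSum_mem_nonInjective_iff.1 h).resolve_right (one_notMem_nonInjective 1)
  oneNotMem := oneNotMem_nonInjective
  primeCondition _ _ _ _ := diagSum_mem_nonInjective_iff.1

end Conditions

/-! ### The embedding into a division ring in the universe of `R`. -/

section Embedding

variable {R : Type u} [Ring R] {M : Type v} [AddCommGroup M] [Module Rᵐᵒᵖ M]

/-- Graphs in `M × M` live in the universe of `M`, but these are indexed by matrices and columns
over `R`; this lets the division ring be moved to the universe of `R`. -/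
instance small_kerGraphs : Small.{u} (kerGraphs R M) := by
  let g : (Σ k : ℕ, Matrix (Fin (k + 1)) (Fin k) R × (Fin (k + 1) → R) × (Fin (k + 1) → R)) →
      AddSubgroup (M × M) := fun p => kerGraph M p.2.1 p.2.2.1 p.2.2.2
  have hg : kerGraphs R M ⊆ Set.range g := by
    rintro _ ⟨k, C, v, c, -, rfl⟩
    exact ⟨⟨k, C, v, c⟩, rfl⟩
  exact small_subset hg

theorem exists_embedding_divisionRing (h₁ : NoInjectiveTall R M) (h₂ : KernelDichotomy R M)
    [FaithfulSMul Rᵐᵒᵖ M] :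
    ∃ (D : Type u) (_ : DivisionRing D) (f : R →+* D), Function.Injective f := by
  have hG := isGermSystem_kerGraphs h₁ h₂
  have : Small.{u} hG.Germ := small_quotient hG.setoid
  let e := equivShrink.{u} hG.Germ
  let : DivisionRing (Shrink.{u} hG.Germ) := e.symm.divisionRing
  exact ⟨Shrink.{u} hG.Germ, inferInstance,
    (e.symm.ringEquiv.symm : hG.Germ →+* Shrink.{u} hG.Germ).comp (toGerm hG),
    e.injective.comp (toGerm_injective hG)⟩

end Embedding

end PrimeMatrixIdeal

theorem lemmaL {R : Type u} [Ring R] {M : Type v} [AddCommGroup M] [Module Rᵐᵒᵖ M]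
    [Nontrivial M] :
    -- the conditions that always hold
    (PrimeMatrixIdeal.ClosedDiagSum (PrimeMatrixIdeal.nonInjective (R := R) M) ∧
      PrimeMatrixIdeal.CancelsOne (PrimeMatrixIdeal.nonInjective (R := R) M) ∧
      PrimeMatrixIdeal.OneNotMem (PrimeMatrixIdeal.nonInjective (R := R) M) ∧
      PrimeMatrixIdeal.PrimeCondition (PrimeMatrixIdeal.nonInjective (R := R) M) ∧
      PrimeMatrixIdeal.ClosedElementaryLeft (PrimeMatrixIdeal.nonInjective (R := R) M)) ∧
    -- necessary and sufficient condition for containing the non-full matrices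
    (PrimeMatrixIdeal.ContainsNonFull (PrimeMatrixIdeal.nonInjective (R := R) M) ↔
      PrimeMatrixIdeal.NoInjectiveTall R M) ∧
    -- sufficient condition for closure under column determinantal sums
    (PrimeMatrixIdeal.KernelDichotomy R M →
      PrimeMatrixIdeal.ClosedNablaCol (PrimeMatrixIdeal.nonInjective (R := R) M)) ∧
    -- the two consequences
    (PrimeMatrixIdeal.NoInjectiveTall R M → PrimeMatrixIdeal.KernelDichotomy R M →
      PrimeMatrixIdeal.IsPrimeMatrixIdeal (PrimeMatrixIdeal.nonInjective (R := R) M)) ∧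
    (PrimeMatrixIdeal.NoInjectiveTall R M → PrimeMatrixIdeal.KernelDichotomy R M →
      FaithfulSMul Rᵐᵒᵖ M →
      ∃ (D : Type u) (_ : DivisionRing D) (f : R →+* D), Function.Injective f) :=
  ⟨⟨fun _ _ _ _ hA => PrimeMatrixIdeal.diagSum_mem_nonInjective_iff.2 (Or.inl hA),
      fun _ _ h => (PrimeMatrixIdeal.diagSum_mem_nonInjective_iff.1 h).resolve_right
        (PrimeMatrixIdeal.one_notMem_nonInjective 1),
      PrimeMatrixIdeal.oneNotMem_nonInjective,
      fun _ _ _ _ => PrimeMatrixIdeal.diagSum_mem_nonInjective_iff.1,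
      PrimeMatrixIdeal.closedElementaryLeft_nonInjective⟩,
    PrimeMatrixIdeal.containsNonFull_nonInjective_iff,
    PrimeMatrixIdeal.closedNablaCol_nonInjective,
    PrimeMatrixIdeal.isPrimeMatrixIdeal_nonInjective,
    fun h₁ h₂ _ => PrimeMatrixIdeal.exists_embedding_divisionRing h₁ h₂⟩
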